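/- For a topological space $X$ let $PX$ be the space of continuous paths $[0,1]\to X$ with the compact-open topology, and let $\pi:PX\to X\times X$, $\pi(\gamma)=(\gamma(0),\gamma(1))$. The topological complexity $\operatorname{tc}(X)$ is the least $m\ge 0$ such that $X\times X$ is covered by $m+1$ open subsets, over each of which $\pi$ has a continuous section (and $\operatorname{tc}(X)=\infty$ if there is no such $m$). For $n\ge 2$ let $\mathbb{S}^1_n=\{a_i,b_i \mid i\in\mathbb{Z}/n\}$ be the Khalimsky circle with $2n$ points: its topology is generated by the sets $\{a_i\}$ and $\{a_i,b_i,a_{i+1}\}$, $i\in\mathbb{Z}/n$. Then $$\operatorname{tc}(\mathbb{S}^1_n)=\begin{cases}3,& n=2,\\ 2,& n=3,4,\\ 1,& n\ge 5.\end{cases}$$ In particular, the conjecture of Tanaka that $\operatorname{tc}(\mathbb{S}^1_{2^k})=2$ for all $k\ge 1$ is false; indeed $\operatorname{tc}(\mathbb{S}^1_{2^k})\ne 2$ for every $k\ge 3$. -/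

import Mathlib

/-- A continuous local section over `U ⊆ X × X` of the path fibration
`π : PX → X × X`, `π γ = (γ 0, γ 1)`. Here `PX = C(unitInterval, X)` carries the compact-open
topology and `U` the subspace topology. -/
def HasPathSection {X : Type*} [TopologicalSpace X] (U : Set (X × X)) : Prop :=
  ∃ s : U → C(unitInterval, X), Continuous s ∧
    ∀ p : U, (s p 0, s p 1) = (p : X × X)

/-- `X × X` is covered by `m + 1` open subsets, each of which admits a continuous section of the
path fibration. -/
def HasMotionPlanner (X : Type*) [TopologicalSpace X] (m : ℕ) : Prop :=
  ∃ U : Fin (m + 1) → Set (X × X),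
    (∀ i, IsOpen (U i)) ∧ (⋃ i, U i) = Set.univ ∧ ∀ i, HasPathSection (U i)

/-- The (reduced) topological complexity of `X`: the least `m` such that `X × X` is covered by
`m + 1` open subsets each admitting a section of the path fibration; it is `⊤` if there is no
such `m`. -/
noncomputable def topologicalComplexity (X : Type*) [TopologicalSpace X] : ℕ∞ :=
  ⨅ (m : ℕ) (_ : HasMotionPlanner X m), (m : ℕ∞)

/-- The underlying set `{a₀, …, aₙ₋₁; b₀, …, bₙ₋₁}` of the Khalimsky circle with `2n` points,
with indices in `ℤ/n`; it is used for `n ≥ 2` only. -/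
inductive KhalimskyCircle (n : ℕ) : Type
  | a (i : ZMod n) : KhalimskyCircle n
  | b (i : ZMod n) : KhalimskyCircle n

/-- The Khalimsky topology: it is generated by the sets `{aᵢ}` and `{aᵢ, bᵢ, aᵢ₊₁}`, `i ∈ ℤ/n`,
so that the `aᵢ` are open points and `{aᵢ, bᵢ, aᵢ₊₁}` is the least open neighbourhood of `bᵢ`.
(For `n ≥ 3` the sets `{aᵢ}` are intersections of the others and could be left out.) -/
instance KhalimskyCircle.instTopologicalSpace (n : ℕ) : TopologicalSpace (KhalimskyCircle n) :=
  TopologicalSpace.generateFrom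
    (Set.range (fun i : ZMod n => ({.a i} : Set (KhalimskyCircle n))) ∪
      Set.range (fun i : ZMod n => ({.a i, .b i, .a (i + 1)} : Set (KhalimskyCircle n))))

/-! A path section over `U` is the same as a homotopy between the two projections `U → X`. For
finite spaces such homotopies are combinatorial: pointwise specializations give homotopies, and
whatever is invariant under them is a homotopy invariant.

Lower bounds: the identity of the circle is comparable with no other map, hence homotopic to none.
So if an open set with a section contains the graph, or transposed graph, of a self-map over the
closed points, that map is the identity (`eq_id_of_graph_subset`). Closed king paths on the `n × n`
grid of pairs `(b i, b j)` supply self-maps. For `n = 2` no two of the four pairs can share a set;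
for `n = 3, 4` every two-colouring of the grid has a monochromatic king path other than the
diagonal, by a finite search; in general a constant map excludes a single set.

Upper bounds: lift the difference of the two coordinates to an integer displacement on `U` and push
the first projection towards the second, one position at a time. This gets stuck only if `U`
contains a whole translate of the diagonal with its nonzero displacement
(`homotopic_of_no_translate`, `hasPathSection_of_displacement`). Complements of crosses give four
sets for `n = 2` and three for `n ≥ 3`. For `n ≥ 5` two sets suffice: a neighbourhood of a staircase
of winding `(1, 1)` that contains no translate of the diagonal, and an open set covering the rest.
-/

open Topology unitInterval

/-! ### Homotopies between maps of finite spaces. -/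

section FiniteHomotopy

variable {P X Y : Type*} [TopologicalSpace P] [TopologicalSpace X] [TopologicalSpace Y]

/-- Maps that are pointwise related by specialization are homotopic. -/
theorem homotopic_of_specializes {f g : C(P, X)} (h : ∀ p, f p ⤳ g p) : f.Homotopic g := by
  classical
  have hs : IsOpen {z : I × P | z.1 < 1} := isOpen_lt continuous_fst continuous_const
  refine ⟨⟨⟨fun z => if z ∈ {z : I × P | z.1 < 1} then f z.2 else g z.2, ?_⟩, ?_, ?_⟩⟩
  · exact hs.continuous_piecewise_of_specializes (f.continuous.comp continuous_snd)
      (g.continuous.comp continuous_snd) fun z => h z.2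
  · intro p
    simp
  · intro p
    simp

/-- On a finite domain, a homotopy moves downwards in the specialization order for short times;
hence a property that is invariant under comparability is invariant under homotopy. -/
theorem ContinuousMap.Homotopic.of_specializes_invariant [Finite P] [AlexandrovDiscrete X]
    {f g : C(P, X)}
    (hfg : f.Homotopic g) (Q : C(P, X) → Prop)
    (hQ : ∀ f g : C(P, X), (∀ p, f p ⤳ g p) → (Q f ↔ Q g)) (hf : Q f) : Q g := by
  obtain ⟨H⟩ := hfg
  have key : ∀ t : I, ∀ᶠ s in 𝓝 t, (Q (H.curry s) ↔ Q (H.curry t)) := by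
    intro t
    have hp : ∀ p, ∀ᶠ s in 𝓝 t, H (s, p) ⤳ H (t, p) := by
      intro p
      have hmem : {x | x ⤳ H (t, p)} ∈ 𝓝 (H (t, p)) := by
        rw [← principal_nhdsKer_singleton, Filter.mem_principal]
        intro x hx
        simpa [mem_nhdsKer_singleton] using hx
      have hc : Continuous fun s : I => H (s, p) := by fun_prop
      exact hc.continuousAt hmem
    filter_upwards [Filter.eventually_all.2 hp] with s hs
    exact hQ _ _ hs
  have hconst : IsLocallyConstant fun t : I => Q (H.curry t) :=
    (IsLocallyConstant.iff_eventually_eq _).2 fun t => (key t).mono fun s hs => propext hs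
  have h01 := hconst.apply_eq_of_preconnectedSpace 0 1
  simp only [ContinuousMap.Homotopy.curry_zero, ContinuousMap.Homotopy.curry_one] at h01
  exact h01 ▸ hf

theorem hasPathSection_of_homotopic {U : Set (X × X)}
    (h : (⟨fun u : U => u.1.1, by fun_prop⟩ : C(U, X)).Homotopic ⟨fun u : U => u.1.2, by fun_prop⟩) :
    HasPathSection U := by
  obtain ⟨H⟩ := h
  let K : C(U × I, X) := H.toContinuousMap.comp ⟨Prod.swap, continuous_swap⟩
  refine ⟨K.curry, K.curry.continuous, fun p => ?_⟩
  have h0 := H.apply_zero p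
  have h1 := H.apply_one p
  exact Prod.ext h0 h1

theorem HasPathSection.homotopic {U : Set (X × X)} (hU : HasPathSection U) {f g : C(Y, X)}
    (h : ∀ y, (f y, g y) ∈ U) : f.Homotopic g := by
  obtain ⟨s, hs, hs'⟩ := hU
  let c : C(Y, U) := ⟨fun y => ⟨(f y, g y), h y⟩, by fun_prop⟩
  let S : C(Y × I, X) := ContinuousMap.uncurry ((⟨s, hs⟩ : C(U, C(I, X))).comp c)
  refine ⟨⟨S.comp ⟨Prod.swap, continuous_swap⟩, fun y => ?_, fun y => ?_⟩⟩
  · exact congrArg Prod.fst (hs' (c y))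
  · exact congrArg Prod.snd (hs' (c y))

/-- A finite space on which only the identity is comparable with the identity is rigid. -/
theorem eq_id_of_homotopic [Finite X]
    (hX : ∀ f : C(X, X), ((∀ x, f x ⤳ x) ∨ ∀ x, x ⤳ f x) → f = ContinuousMap.id X)
    {f : C(X, X)} (h : (ContinuousMap.id X).Homotopic f) : f = ContinuousMap.id X := by
  refine h.of_specializes_invariant (fun f => f = ContinuousMap.id X) (fun f g hfg => ?_) rfl
  constructor
  · rintro rfl
    exact hX g (.inr hfg)
  · rintro rfl
    exact hX f (.inl hfg)

end FiniteHomotopy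

section MotionPlanner

variable {X : Type*} [TopologicalSpace X]

theorem HasMotionPlanner.mono {k m : ℕ} (h : HasMotionPlanner X k) (hkm : k ≤ m) :
    HasMotionPlanner X m := by
  obtain ⟨U, hU, hcov, hs⟩ := h
  refine ⟨fun i => U ⟨min i.1 k, by omega⟩, fun i => hU _, ?_, fun i => hs _⟩
  rw [Set.eq_univ_iff_forall] at hcov ⊢
  intro z
  obtain ⟨i, hi⟩ := Set.mem_iUnion.1 (hcov z)
  refine Set.mem_iUnion.2 ⟨⟨i.1, by omega⟩, ?_⟩
  have : (⟨min i.1 k, by omega⟩ : Fin (k + 1)) = i := Fin.ext (by simp; omega)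
  simpa only [this] using hi

theorem topologicalComplexity_eq_succ {m : ℕ} (h : HasMotionPlanner X (m + 1))
    (h' : ¬ HasMotionPlanner X m) : topologicalComplexity X = ((m + 1 : ℕ) : ℕ∞) := by
  refine le_antisymm (iInf₂_le _ h) (le_iInf₂ fun k hk => ?_)
  by_contra hlt
  exact h' (hk.mono (by rw [not_le, Nat.cast_lt] at hlt; omega))

end MotionPlanner

/-! ### Positions on the Khalimsky circle and its covering by the integers. -/

namespace KhalimskyCircle

variable {n : ℕ}

theorem isOpen_singleton_a (i : ZMod n) : IsOpen ({a i} : Set (KhalimskyCircle n)) :=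
  TopologicalSpace.isOpen_generateFrom_of_mem (.inl ⟨i, rfl⟩)

theorem isOpen_star (i : ZMod n) : IsOpen ({a i, b i, a (i + 1)} : Set (KhalimskyCircle n)) :=
  TopologicalSpace.isOpen_generateFrom_of_mem (.inr ⟨i, rfl⟩)

theorem specializes_a_iff {x : KhalimskyCircle n} {i : ZMod n} : x ⤳ a i ↔ x = a i := by
  refine ⟨fun h => ?_, specializes_of_eq⟩
  simpa using h.mem_open (isOpen_singleton_a i) rfl

theorem specializes_b_iff {x : KhalimskyCircle n} {i : ZMod n} :
    x ⤳ b i ↔ x = a i ∨ x = b i ∨ x = a (i + 1) := by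
  refine ⟨fun h => ?_, fun h => ?_⟩
  · simpa using h.mem_open (isOpen_star i) (by simp)
  · rw [specializes_iff_pure, TopologicalSpace.nhds_generateFrom]
    refine le_iInf₂ fun s hs => ?_
    rw [Filter.le_principal_iff, Filter.mem_pure]
    obtain ⟨hb, ⟨j, rfl⟩ | ⟨j, rfl⟩⟩ := hs
    · simp at hb
    · simp at hb
      subst hb
      simpa using h

/-- The position of a point of the circle, in the cyclic order `a₀, b₀, a₁, b₁, …`. -/
def pos : KhalimskyCircle n → ℤ
  | a i => 2 * i.val
  | b i => 2 * i.val + 1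

/-- The covering of the Khalimsky circle by the integers. -/
def pt (n : ℕ) (k : ℤ) : KhalimskyCircle n :=
  if Even k then a ((k / 2 : ℤ) : ZMod n) else b ((k / 2 : ℤ) : ZMod n)

theorem pt_two_mul (k : ℤ) : pt n (2 * k) = a (k : ZMod n) := by
  simp [pt]

theorem pt_two_mul_add_one (k : ℤ) : pt n (2 * k + 1) = b (k : ZMod n) := by
  have h : (2 * k + 1) / 2 = k := by omega
  rw [pt, if_neg (by rw [Int.not_even_iff_odd]; exact odd_two_mul_add_one k), h]

theorem pt_eq_pt_iff {k l : ℤ} : pt n k = pt n l ↔ (2 * n : ℤ) ∣ k - l := by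
  rcases Int.even_or_odd' k with ⟨k, rfl | rfl⟩ <;> rcases Int.even_or_odd' l with ⟨l, rfl | rfl⟩
  · rw [← mul_sub, mul_dvd_mul_iff_left two_ne_zero, pt_two_mul, pt_two_mul]
    simp [eq_comm (a := (k : ZMod n)), ZMod.intCast_eq_intCast_iff_dvd_sub]
  · have : ¬ (2 * n : ℤ) ∣ 2 * k - (2 * l + 1) := fun h => by
      have := (Dvd.intro _ rfl).trans h
      omega
    simp [pt_two_mul, pt_two_mul_add_one, this]
  · have : ¬ (2 * n : ℤ) ∣ 2 * k + 1 - 2 * l := fun h => by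
      have := (Dvd.intro _ rfl).trans h
      omega
    simp [pt_two_mul, pt_two_mul_add_one, this]
  · rw [show 2 * k + 1 - (2 * l + 1) = 2 * (k - l) by ring, mul_dvd_mul_iff_left two_ne_zero,
      pt_two_mul_add_one, pt_two_mul_add_one]
    simp [eq_comm (a := (k : ZMod n)), ZMod.intCast_eq_intCast_iff_dvd_sub]

theorem pt_specializes_pt {k l : ℤ} (h : k = l ∨ Even k ∧ (l = k + 1 ∨ l = k - 1)) :
    pt n k ⤳ pt n l := by
  rcases h with rfl | ⟨⟨k, rfl⟩, rfl | rfl⟩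
  · rfl
  · rw [← two_mul, pt_two_mul, pt_two_mul_add_one, specializes_b_iff]
    simp
  · rw [← two_mul, show 2 * k - 1 = 2 * (k - 1) + 1 by ring, pt_two_mul, pt_two_mul_add_one,
      specializes_b_iff]
    simp

theorem pos_nonneg (x : KhalimskyCircle n) : 0 ≤ pos x := by
  cases x <;> simp only [pos] <;> positivity

section NeZero

variable [NeZero n]

theorem pos_lt (x : KhalimskyCircle n) : pos x < 2 * n := by
  cases x with
  | a i => have := i.val_lt; simp only [pos]; omega
  | b i => have := i.val_lt; simp only [pos]; omega

@[simp]
theorem pt_pos (x : KhalimskyCircle n) : pt n (pos x) = x := by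
  cases x with
  | a i => rw [pos, pt_two_mul]; simp
  | b i => rw [pos, pt_two_mul_add_one]; simp

theorem pos_injective : Function.Injective (pos : KhalimskyCircle n → ℤ) :=
  Function.LeftInverse.injective pt_pos

instance : Finite (KhalimskyCircle n) :=
  Finite.of_injective (fun x => (⟨(pos x).toNat, by have := pos_lt x; have := pos_nonneg x; omega⟩ :
    Fin (2 * n))) fun x y h => pos_injective (by
      have := pos_nonneg x
      have := pos_nonneg y
      simp only [Fin.mk.injEq] at h
      omega)

theorem dvd_pos_pt_sub (k : ℤ) : (2 * n : ℤ) ∣ pos (pt n k) - k :=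
  pt_eq_pt_iff.1 (pt_pos _)

theorem pos_pt_eq {k l : ℤ} (h : (2 * n : ℤ) ∣ k - l) (h0 : 0 ≤ l) (hl : l < 2 * n) :
    pos (pt n k) = l := by
  have h1 := dvd_pos_pt_sub (n := n) k
  have h2 := pos_nonneg (pt n k)
  have h3 := pos_lt (pt n k)
  obtain ⟨c, hc⟩ : (2 * n : ℤ) ∣ pos (pt n k) - l := by
    simpa using dvd_add h1 h
  have : c = 0 := by
    rcases lt_trichotomy c 0 with h | h | h
    · nlinarith
    · exact h
    · nlinarith
  subst this
  omega

/-- The specialization order in terms of positions. -/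
theorem pos_of_specializes {x y : KhalimskyCircle n} (h : x ⤳ y) :
    pos y = pos x ∨ Even (pos x) ∧
      (pos y = pos x + 1 ∨ pos y = pos x - 1 ∨ pos x = 0 ∧ pos y = 2 * n - 1) := by
  cases y with
  | a i => rw [specializes_a_iff] at h; simp [h]
  | b i =>
    rcases specializes_b_iff.1 h with rfl | rfl | rfl
    · simp [pos]
    · simp
    · right
      have hi := i.val_lt
      by_cases hn : i.val + 1 < n
      · have : (i + 1).val = i.val + 1 := by
          rw [ZMod.val_add_of_lt]
          · rw [ZMod.val_one'' (by omega)]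
          · rw [ZMod.val_one'' (by omega)]
            omega
        simp only [pos, this]
        exact ⟨even_two_mul _, by omega⟩
      · have : i.val + 1 = n := by omega
        have h0 : i + 1 = 0 := by
          have := congrArg (Nat.cast : ℕ → ZMod n) this
          simpa using this
        simp only [pos, h0, ZMod.val_zero]
        exact ⟨even_two_mul _, by omega⟩

end NeZero

end KhalimskyCircle

theorem continuous_of_forall_specializes {P X : Type*} [TopologicalSpace P] [TopologicalSpace X]
    [AlexandrovDiscrete P] {f : P → X} (h : ∀ u v, u ⤳ v → f u ⤳ f v) : Continuous f :=
  continuous_def.2 fun _ hs => isOpen_iff_forall_specializes.2 fun u v huv hv =>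
    (h u v huv).mem_open hs hv

/-! ### Increments of maps to the circle, and moving points forward. -/

namespace KhalimskyCircle

variable {n : ℕ} {P : Type*} [TopologicalSpace P] {G D : P → ℤ} {E : P → P → ℤ}

/-- `E` records the increments, in `{-1, 0, 1}`, of a map `u ↦ pt n (G u)` to the Khalimsky circle
along specializations. -/
def IsIncrement (n : ℕ) (G : P → ℤ) (E : P → P → ℤ) : Prop :=
  ∀ u v, u ⤳ v → (2 * n : ℤ) ∣ G v - G u - E u v ∧ -1 ≤ E u v ∧ E u v ≤ 1 ∧
    (E u v ≠ 0 → G u % 2 = 0)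

theorem IsIncrement.mod_two (hE : IsIncrement n G E) {u v : P} (h : u ⤳ v) :
    (G v - G u - E u v) % 2 = 0 :=
  Int.emod_eq_zero_of_dvd ((Dvd.intro _ rfl).trans (hE u v h).1)

/-- The two sides agree modulo `2 * n` and differ by at most `3 < 2 * n`. -/
theorem IsIncrement.add (hE : IsIncrement n G E) (hn : 2 ≤ n) {u v w : P} (huv : u ⤳ v)
    (hvw : v ⤳ w) : E u w = E u v + E v w := by
  obtain ⟨h1, h1', h1'', h1e⟩ := hE u v huv
  obtain ⟨h2, h2', h2'', h2e⟩ := hE v w hvw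
  obtain ⟨h3, h3', h3'', h3e⟩ := hE u w (huv.trans hvw)
  have hm := hE.mod_two huv
  have hd : (2 * n : ℤ) ∣ E u w - (E u v + E v w) := by
    have := dvd_sub (dvd_add h1 h2) h3
    rwa [show G v - G u - E u v + (G w - G v - E v w) - (G w - G u - E u w) =
      E u w - (E u v + E v w) by ring] at this
  have hlt : |E u w - (E u v + E v w)| < 2 * n := by
    rw [abs_lt]
    omega
  have := Int.eq_zero_of_abs_lt_dvd hd hlt
  omega

theorem continuous_pt_of_isIncrement [AlexandrovDiscrete P] (hE : IsIncrement n G E) :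
    Continuous fun u => pt n (G u) := by
  refine continuous_of_forall_specializes fun u v huv => ?_
  obtain ⟨h1, h1', h1'', h1e⟩ := hE u v huv
  have : pt n (G v) = pt n (G u + E u v) :=
    pt_eq_pt_iff.2 (by rwa [← sub_sub])
  rw [this]
  refine pt_specializes_pt ?_
  rw [Int.even_iff]
  omega

/-- The increments of the map obtained by moving back `u ↦ pt n (G u)` by `D`. -/
def shiftIncrement (E : P → P → ℤ) (D : P → ℤ) (u v : P) : ℤ :=
  E u v - (D v - D u)

open Classical in
/-- Decrease `D` by one on `S`. -/
noncomputable def decrease (D : P → ℤ) (S : Set P) (u : P) : ℤ :=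
  if u ∈ S then D u - 1 else D u

/-- The points with even position that can be moved forward. -/
def evenFree (G : P → ℤ) (E : P → P → ℤ) (D : P → ℤ) : Set P :=
  {u | 0 < D u ∧ (G u - D u) % 2 = 0 ∧ ∀ v, u ⤳ v → shiftIncrement E D u v ≠ -1}

/-- The points with odd position that can be moved forward. -/
def oddFree (G : P → ℤ) (E : P → P → ℤ) (D : P → ℤ) : Set P :=
  {u | 0 < D u ∧ (G u - D u) % 2 = 1 ∧ ∀ v, v ⤳ u → shiftIncrement E D v u ≠ 1}

/-- A point moved from an even to an odd position must agree with everything it specializes to.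
Points one ahead stay put; points at the same position move along, because whatever blocks them also
blocks `u` by transitivity. -/
theorem isIncrement_decrease_evenFree (hn : 2 ≤ n) (hE : IsIncrement n G E) (h0 : ∀ u, 0 ≤ D u)
    (hD : IsIncrement n (G - D) (shiftIncrement E D)) :
    IsIncrement n (G - decrease D (evenFree G E D))
      (shiftIncrement E (decrease D (evenFree G E D))) := by
  intro u v huv
  obtain ⟨h1, h2, h3, h4⟩ := hD u v huv
  have hm := hD.mod_two huv
  have k0 := hE u v huv
  have km := hE.mod_two huv
  have hu0 := h0 u
  have hv0 := h0 v
  refine ⟨?_, ?_⟩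
  · convert hE u v huv |>.1 using 1
    simp only [Pi.sub_apply, shiftIncrement]
    ring
  simp only [Pi.sub_apply, shiftIncrement, decrease] at *
  by_cases hus : u ∈ evenFree G E D
  · have hu' : 0 < D u ∧ (G u - D u) % 2 = 0 ∧ ∀ w, u ⤳ w →
        shiftIncrement E D u w ≠ -1 := hus
    have hb := hu'.2.2 v huv
    simp only [shiftIncrement] at hb
    by_cases hvs : v ∈ evenFree G E D
    · have hv' : 0 < D v ∧ (G v - D v) % 2 = 0 ∧ ∀ w, v ⤳ w →
        shiftIncrement E D v w ≠ -1 := hvs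
      simp only [hus, hvs, if_true]
      omega
    · simp only [hus, hvs, if_true, if_false]
      by_cases he : E u v - (D v - D u) = 0
      · exfalso
        have : ∃ w, v ⤳ w ∧ E v w - (D w - D v) = -1 := by
          by_contra hcon
          push Not at hcon
          refine hvs ⟨?_, by omega, hcon⟩
          -- If `E u v ≠ 0`, then `G u` is even, hence so is `D u`, which is then at least 2; this
          -- keeps `D v` positive.
          omega
        obtain ⟨w, hvw, hw⟩ := this
        have hadd := hE.add hn huv hvw
        have := hu'.2.2 w (huv.trans hvw)
        simp only [shiftIncrement] at this
        omega
      · omega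
  · by_cases hvs : v ∈ evenFree G E D
    · have hv' : 0 < D v ∧ (G v - D v) % 2 = 0 ∧ ∀ w, v ⤳ w →
        shiftIncrement E D v w ≠ -1 := hvs
      simp only [hus, hvs, if_true, if_false]
      omega
    · simp only [hus, hvs, if_false]
      omega

/-- Mirror image of the even case: an odd position is blocked by points specializing to it. -/
theorem isIncrement_decrease_oddFree (hn : 2 ≤ n) (hE : IsIncrement n G E) (h0 : ∀ u, 0 ≤ D u)
    (hD : IsIncrement n (G - D) (shiftIncrement E D)) :
    IsIncrement n (G - decrease D (oddFree G E D))
      (shiftIncrement E (decrease D (oddFree G E D))) := by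
  intro u v huv
  obtain ⟨h1, h2, h3, h4⟩ := hD u v huv
  have hm := hD.mod_two huv
  have k0 := hE u v huv
  have km := hE.mod_two huv
  have hu0 := h0 u
  have hv0 := h0 v
  refine ⟨?_, ?_⟩
  · convert hE u v huv |>.1 using 1
    simp only [Pi.sub_apply, shiftIncrement]
    ring
  simp only [Pi.sub_apply, shiftIncrement, decrease] at *
  by_cases hvs : v ∈ oddFree G E D
  · have hv' : 0 < D v ∧ (G v - D v) % 2 = 1 ∧ ∀ w, w ⤳ v →
        shiftIncrement E D w v ≠ 1 := hvs
    have hb := hv'.2.2 u huv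
    simp only [shiftIncrement] at hb
    by_cases hus : u ∈ oddFree G E D
    · have hu' : 0 < D u ∧ (G u - D u) % 2 = 1 ∧ ∀ w, w ⤳ u →
        shiftIncrement E D w u ≠ 1 := hus
      simp only [hus, hvs, if_true]
      omega
    · simp only [hus, hvs, if_true, if_false]
      by_cases he : E u v - (D v - D u) = 0
      · exfalso
        have : ∃ w, w ⤳ u ∧ E w u - (D u - D w) = 1 := by
          by_contra hcon
          push Not at hcon
          refine hus ⟨?_, by omega, hcon⟩
          omega
        obtain ⟨w, hwu, hw⟩ := this
        have hadd := hE.add hn hwu huv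
        have := hv'.2.2 w (hwu.trans huv)
        simp only [shiftIncrement] at this
        omega
      · omega
  · by_cases hus : u ∈ oddFree G E D
    · have hu' : 0 < D u ∧ (G u - D u) % 2 = 1 ∧ ∀ w, w ⤳ u →
        shiftIncrement E D w u ≠ 1 := hus
      simp only [hus, hvs, if_true, if_false]
      omega
    · simp only [hus, hvs, if_false]
      omega

end KhalimskyCircle

/-! ### Homotopies obtained by decreasing a displacement. -/

namespace KhalimskyCircle

section Decrease

variable {P : Type*} {D : P → ℤ}

theorem decrease_nonneg {S : Set P} (h0 : ∀ u, 0 ≤ D u) (hS : ∀ u ∈ S, 0 < D u) (u : P) :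
    0 ≤ decrease D S u := by
  have := h0 u
  by_cases hu : u ∈ S
  · have := hS u hu
    simp only [decrease, hu, if_true]
    omega
  · simpa [decrease, hu]

theorem decrease_le (S : Set P) (u : P) : decrease D S u ≤ D u := by
  by_cases hu : u ∈ S <;> simp [decrease, hu]

theorem sum_decrease_lt [Fintype P] {S : Set P} (hS : S.Nonempty) :
    ∑ u, decrease D S u < ∑ u, D u := by
  obtain ⟨u, hu⟩ := hS
  exact Finset.sum_lt_sum (fun v _ => decrease_le S v)
    ⟨u, Finset.mem_univ u, by simp [decrease, hu]⟩

end Decrease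

variable {n : ℕ} {P : Type*} [TopologicalSpace P] {G D D₀ : P → ℤ} {E : P → P → ℤ}

/-- The continuous map to the Khalimsky circle given by a function with increments. -/
def IsIncrement.toMap [AlexandrovDiscrete P] (hE : IsIncrement n G E) :
    C(P, KhalimskyCircle n) :=
  ⟨fun u => pt n (G u), continuous_pt_of_isIncrement hE⟩

theorem homotopic_decrease_evenFree [AlexandrovDiscrete P]
    (hD : IsIncrement n (G - D) (shiftIncrement E D))
    (hD' : IsIncrement n (G - decrease D (evenFree G E D))
      (shiftIncrement E (decrease D (evenFree G E D)))) :
    hD.toMap.Homotopic hD'.toMap := by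
  refine homotopic_of_specializes fun u => pt_specializes_pt ?_
  by_cases hu : u ∈ evenFree G E D
  · have := hu.2.1
    simp only [Pi.sub_apply, decrease, hu, if_true, Int.even_iff]
    omega
  · simp [decrease, hu]

theorem homotopic_decrease_oddFree [AlexandrovDiscrete P]
    (hD : IsIncrement n (G - D) (shiftIncrement E D))
    (hD' : IsIncrement n (G - decrease D (oddFree G E D))
      (shiftIncrement E (decrease D (oddFree G E D)))) :
    hD.toMap.Homotopic hD'.toMap := by
  refine (homotopic_of_specializes fun u => pt_specializes_pt ?_).symm
  by_cases hu : u ∈ oddFree G E D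
  · have := hu.2.1
    simp only [Pi.sub_apply, decrease, hu, if_true, Int.even_iff]
    omega
  · simp [decrease, hu]

/-- If no point can be moved forward, then there is a set of points along which both maps run
backwards at full speed. -/
theorem exists_translate_of_stuck [Finite P] (hE : IsIncrement n G E)
    (hD₀ : IsIncrement n (G - D₀) (shiftIncrement E D₀))
    (he : ¬ (evenFree G E D).Nonempty) (ho : ¬ (oddFree G E D).Nonempty) (hpos : ∃ u, 0 < D u) :
    ∃ T : Set P, T.Nonempty ∧ (∀ u ∈ T, 0 < D u) ∧ ∀ u ∈ T, ∃ v ∈ T, D₀ v = D₀ u ∧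
      (u ⤳ v ∧ E u v = -1 ∨ v ⤳ u ∧ E v u = 1) := by
  obtain ⟨u₁, hu₁⟩ := hpos
  have : Nonempty P := ⟨u₁⟩
  obtain ⟨u₂, hu₂⟩ := Finite.exists_max D
  -- Maximality of `D` forces a point `v` blocking `u` to have `D v = D u` and a full step of `E`;
  -- minimality of `D₀` then forces `D₀ v = D₀ u`.
  obtain ⟨u₃, hu₃, hmin⟩ := Set.exists_min_image {u | D u = D u₂} D₀ (Set.toFinite _) ⟨u₂, rfl⟩
  have hpos : ∀ u, D u = D u₂ ∧ D₀ u = D₀ u₃ → 0 < D u := fun u hu => by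
    have := hu₂ u₁
    omega
  refine ⟨{u | D u = D u₂ ∧ D₀ u = D₀ u₃}, ⟨u₃, hu₃, rfl⟩, hpos, fun u hu => ?_⟩
  have hDu : D u = D u₂ := hu.1
  have hD₀u : D₀ u = D₀ u₃ := hu.2
  have hlt : 0 < D u := hpos u hu
  have hstep : (∃ v, u ⤳ v ∧ shiftIncrement E D u v = -1) ∨
      ∃ v, v ⤳ u ∧ shiftIncrement E D v u = 1 := by
    by_contra hcon
    push Not at hcon
    rcases Int.emod_two_eq_zero_or_one (G u - D u) with h | h
    · exact he ⟨u, hlt, h, hcon.1⟩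
    · exact ho ⟨u, hlt, h, hcon.2⟩
  rcases hstep with ⟨v, huv, hv⟩ | ⟨v, hvu, hv⟩
  · obtain ⟨-, h1, -, -⟩ := hD₀ u v huv
    have hv2 := hu₂ v
    obtain ⟨-, h4, -, -⟩ := hE u v huv
    simp only [shiftIncrement] at *
    have hDv : D v = D u₂ := by omega
    have := hmin v hDv
    exact ⟨v, ⟨hDv, by omega⟩, by omega, .inl ⟨huv, by omega⟩⟩
  · obtain ⟨-, -, h1, -⟩ := hD₀ v u hvu
    have hv2 := hu₂ v
    obtain ⟨-, -, h4, -⟩ := hE v u hvu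
    simp only [shiftIncrement] at *
    have hDv : D v = D u₂ := by omega
    have := hmin v hDv
    exact ⟨v, ⟨hDv, by omega⟩, by omega, .inr ⟨hvu, by omega⟩⟩

/-- Induction on the total displacement: `D` shrinks, while the obstruction is stated for the fixed
initial `D₀`. -/
theorem homotopic_of_no_translate_of_nonneg [Finite P] (hn : 2 ≤ n) (hE : IsIncrement n G E)
    (hT : ∀ T : Set P, T.Nonempty → (∀ u ∈ T, 0 < D₀ u) → ¬ ∀ u ∈ T, ∃ v ∈ T, D₀ v = D₀ u ∧
      (u ⤳ v ∧ E u v = -1 ∨ v ⤳ u ∧ E v u = 1))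
    (hD₀ : IsIncrement n (G - D₀) (shiftIncrement E D₀))
    (h0 : ∀ u, 0 ≤ D u) (hle : ∀ u, D u ≤ D₀ u)
    (hD : IsIncrement n (G - D) (shiftIncrement E D)) :
    hD.toMap.Homotopic hE.toMap := by
  have := Fintype.ofFinite P
  induction hN : (∑ u, D u).toNat using Nat.strong_induction_on generalizing D with
  | _ N ih =>
    have hlt : ∀ S : Set P, S.Nonempty → (∀ u ∈ S, 0 < D u) →
        (∑ u, decrease D S u).toNat < N := by
      intro S hS hS'
      have h1 := sum_decrease_lt (D := D) hS
      have h2 : 0 ≤ ∑ u, decrease D S u :=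
        Finset.sum_nonneg fun u _ => decrease_nonneg h0 hS' u
      omega
    by_cases he : (evenFree G E D).Nonempty
    · have hS : ∀ u ∈ evenFree G E D, 0 < D u := fun u hu => hu.1
      have hD' := isIncrement_decrease_evenFree hn hE h0 hD
      exact (homotopic_decrease_evenFree hD hD').trans
        (ih _ (hlt _ he hS) (decrease_nonneg h0 hS)
          (fun u => (decrease_le _ u).trans (hle u)) hD' rfl)
    by_cases ho : (oddFree G E D).Nonempty
    · have hS : ∀ u ∈ oddFree G E D, 0 < D u := fun u hu => hu.1
      have hD' := isIncrement_decrease_oddFree hn hE h0 hD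
      exact (homotopic_decrease_oddFree hD hD').trans
        (ih _ (hlt _ ho hS) (decrease_nonneg h0 hS)
          (fun u => (decrease_le _ u).trans (hle u)) hD' rfl)
    by_cases hpos : ∃ u, 0 < D u
    · obtain ⟨T, hne, hTpos, hT'⟩ := exists_translate_of_stuck hE hD₀ he ho hpos
      exact absurd hT' (hT T hne fun u hu => (hTpos u hu).trans_le (hle u))
    · have hzero : D = 0 := by
        ext u
        have := h0 u
        have : ¬ 0 < D u := fun h => hpos ⟨u, h⟩
        simp only [Pi.zero_apply]
        omega
      subst hzero
      have : hD.toMap = hE.toMap := by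
        ext u
        simp [IsIncrement.toMap]
      rw [this]

/-- Two maps to the Khalimsky circle with a displacement function between them are homotopic,
unless there are points with nonzero displacement along which both run backwards at full speed. -/
theorem homotopic_of_no_translate [Finite P] (hn : 2 ≤ n) (hE : IsIncrement n G E)
    (hD : IsIncrement n (G - D) (shiftIncrement E D))
    (hT : ∀ T : Set P, T.Nonempty → (∀ u ∈ T, D u ≠ 0) → ¬ ∀ u ∈ T, ∃ v ∈ T, D v = D u ∧
      (u ⤳ v ∧ E u v = -1 ∨ v ⤳ u ∧ E v u = 1)) :
    hD.toMap.Homotopic hE.toMap := by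
  -- The map given by `G - Dp` is pointwise the one further back among `G` and `G - D`, so forward
  -- moves lead from it to both.
  let Dp : P → ℤ := fun u => max (D u) 0
  let Dm : P → ℤ := fun u => max (-D u) 0
  have hp : IsIncrement n (G - Dp) (shiftIncrement E Dp) := by
    intro u v huv
    have h1 := hE u v huv
    have h2 := hD u v huv
    simp only [shiftIncrement, Pi.sub_apply, Dp] at *
    refine ⟨?_, by omega⟩
    convert h1.1 using 1
    ring
  have hG : G - D - Dm = G - Dp := by
    ext u
    simp only [Pi.sub_apply, Dp, Dm]
    omega
  have hE' : shiftIncrement (shiftIncrement E D) Dm = shiftIncrement E Dp := by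
    ext u v
    simp only [shiftIncrement, Dp, Dm]
    omega
  have hm : IsIncrement n (G - D - Dm) (shiftIncrement (shiftIncrement E D) Dm) := by
    rwa [hG, hE']
  have hpm : hp.toMap = hm.toMap := by
    ext u
    exact congrArg (pt n) (congrFun hG u).symm
  have h1 : hp.toMap.Homotopic hE.toMap := by
    refine homotopic_of_no_translate_of_nonneg hn hE (fun T hne hpos h => ?_) hp
      (fun u => le_max_right _ _) (fun u => le_rfl) hp
    refine hT T hne (fun u hu => ?_) fun u hu => ?_
    · have := hpos u hu
      simp only [Dp] at this
      omega
    · obtain ⟨v, hv, hv', h⟩ := h u hu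
      have := hpos u hu
      refine ⟨v, hv, ?_, h⟩
      simp only [Dp] at this hv'
      omega
  have h2 : hm.toMap.Homotopic hD.toMap := by
    refine homotopic_of_no_translate_of_nonneg hn hD (fun T hne hpos h => ?_) hm
      (fun u => le_max_right _ _) (fun u => le_rfl) hm
    refine hT T hne (fun u hu => ?_) fun u hu => ?_
    · have := hpos u hu
      simp only [Dm] at this
      omega
    · obtain ⟨v, hv, hv', h⟩ := h u hu
      have := hpos u hu
      have hvu : D v = D u := by
        simp only [Dm] at this hv'
        omega
      refine ⟨v, hv, hvu, ?_⟩
      simpa [shiftIncrement, hvu] using h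
  exact (hpm ▸ h2).symm.trans h1

end KhalimskyCircle

/-! ### Path sections from displacement functions. -/

namespace KhalimskyCircle

variable {n : ℕ}

/-- The signed step from one position to a neighbouring one on the Khalimsky circle. -/
def posStep (k l : ℤ) : ℤ :=
  if l = k then 0 else if l = k + 1 then 1 else -1

theorem isIncrement_posStep [NeZero n] (hn : 2 ≤ n) {P : Type*} [TopologicalSpace P]
    {f : P → KhalimskyCircle n} (hf : Continuous f) :
    IsIncrement n (fun u => pos (f u)) fun u v => posStep (pos (f u)) (pos (f v)) := by
  intro u v huv
  have h := pos_of_specializes (huv.map hf)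
  rw [Int.even_iff] at h
  change (2 * n : ℤ) ∣ pos (f v) - pos (f u) - posStep (pos (f u)) (pos (f v)) ∧
    -1 ≤ posStep (pos (f u)) (pos (f v)) ∧ posStep (pos (f u)) (pos (f v)) ≤ 1 ∧
    (posStep (pos (f u)) (pos (f v)) ≠ 0 → pos (f u) % 2 = 0)
  have hb : -1 ≤ posStep (pos (f u)) (pos (f v)) ∧ posStep (pos (f u)) (pos (f v)) ≤ 1 := by
    unfold posStep
    split_ifs <;> simp
  refine ⟨?_, hb.1, hb.2, fun h' => ?_⟩
  · rcases h with h | ⟨h0, h | h | ⟨h1, h2⟩⟩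
    · simp [posStep, h]
    · simp [posStep, h]
    · rw [posStep, if_neg (by omega), if_neg (by omega), h]
      simp
    -- The wrap-around from `0` to `2 * n - 1` falls into the default value `-1`; the reverse jump
    -- would start at an odd position.
    · rw [posStep, if_neg (by omega), if_neg (by omega), h1, h2]
      exact ⟨1, by ring⟩
  · rcases h with h | h
    · simp [posStep, h] at h'
    · exact h.1

/-- A subset of the torus has a path section if it carries a displacement function
and does not contain a whole translate of the diagonal with nonzero displacement. -/
theorem hasPathSection_of_displacement [NeZero n] (hn : 2 ≤ n)
    {U : Set (KhalimskyCircle n × KhalimskyCircle n)} (D : KhalimskyCircle n × KhalimskyCircle n → ℤ)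
    (hD : ∀ z ∈ U, (2 * n : ℤ) ∣ pos z.2 - D z - pos z.1)
    (hstep : ∀ z ∈ U, ∀ w ∈ U, z ⤳ w →
      D w - D z = posStep (pos z.2) (pos w.2) - posStep (pos z.1) (pos w.1))
    (hline : ∀ K : ℤ, K % 2 = 0 → K ≠ 0 →
      ∃ p : ℤ, ¬ ((pt n p, pt n (p + K)) ∈ U ∧ D (pt n p, pt n (p + K)) = K)) : HasPathSection U := by
  have hE := isIncrement_posStep hn (f := fun u : U => u.1.2) (by fun_prop)
  have hE₁ := isIncrement_posStep hn (f := fun u : U => u.1.1) (by fun_prop)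
  have hD₀ : IsIncrement n ((fun u : U => pos u.1.2) - fun u : U => D u.1)
      (shiftIncrement (fun u v : U => posStep (pos u.1.2) (pos v.1.2)) fun u : U => D u.1) := by
    intro u v huv
    obtain ⟨h1, h2, h3, h4⟩ := hE₁ u v huv
    have hs := hstep u.1 u.2 v.1 v.2 ((subtype_specializes_iff u v).1 huv)
    have hu := hD u.1 u.2
    have hv := hD v.1 v.2
    have hu2 : (pos u.1.2 - D u.1 - pos u.1.1) % 2 = 0 :=
      Int.emod_eq_zero_of_dvd ((Dvd.intro _ rfl).trans hu)
    have : shiftIncrement (fun u v : U => posStep (pos u.1.2) (pos v.1.2)) (fun u : U => D u.1) u v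
        = posStep (pos u.1.1) (pos v.1.1) := by
      simp only [shiftIncrement]
      omega
    rw [this]
    refine ⟨?_, h2, h3, fun h => ?_⟩
    · refine (dvd_add (dvd_sub hv hu) h1).trans (dvd_of_eq ?_)
      simp only [Pi.sub_apply]
      ring
    · have := h4 h
      simp only [Pi.sub_apply] at this ⊢
      omega
  have hT : ∀ T : Set U, T.Nonempty → (∀ u ∈ T, D u.1 ≠ 0) → ¬ ∀ u ∈ T, ∃ v ∈ T, D v.1 = D u.1 ∧
      (u ⤳ v ∧ posStep (pos u.1.2) (pos v.1.2) = -1 ∨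
        v ⤳ u ∧ posStep (pos v.1.2) (pos u.1.2) = 1) := by
    rintro T ⟨u₀, hu₀⟩ hT0 hT
    -- Both coordinates make a nonzero step from the same point, so both positions there are even.
    have heven : D u₀.1 % 2 = 0 := by
      obtain ⟨v, -, hv, ⟨h1, h2⟩ | ⟨h1, h2⟩⟩ := hT u₀ hu₀
      · have h3 : pos u₀.1.2 % 2 = 0 := (hE u₀ v h1).2.2.2 (by dsimp only; omega)
        have h4 : (pos u₀.1.2 - D u₀.1) % 2 = 0 :=
          (hD₀ u₀ v h1).2.2.2 (by simp only [shiftIncrement]; omega)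
        omega
      · have h3 : pos v.1.2 % 2 = 0 := (hE v u₀ h1).2.2.2 (by dsimp only; omega)
        have h4 : (pos v.1.2 - D v.1) % 2 = 0 :=
          (hD₀ v u₀ h1).2.2.2 (by simp only [shiftIncrement]; omega)
        omega
    -- Each step in `T` moves the second coordinate back by one at fixed displacement, so `T` goes
    -- all the way round.
    have hall : ∀ k : ℕ, ∃ u ∈ T, D u.1 = D u₀.1 ∧
        (2 * n : ℤ) ∣ pos u.1.2 - (pos u₀.1.2 - k) := by
      intro k
      induction k with
      | zero => exact ⟨u₀, hu₀, rfl, by simp⟩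
      | succ k ih =>
        obtain ⟨u, hu, hDu, hk⟩ := ih
        obtain ⟨v, hv, hDv, ⟨h1, h2⟩ | ⟨h1, h2⟩⟩ := hT u hu
        · refine ⟨v, hv, hDv.trans hDu, ?_⟩
          have h3 := (hE u v h1).1
          simp only [h2] at h3
          exact (dvd_add h3 hk).trans (dvd_of_eq (by push_cast; ring))
        · refine ⟨v, hv, hDv.trans hDu, ?_⟩
          have h3 := (hE v u h1).1
          simp only [h2] at h3
          exact (dvd_sub hk h3).trans (dvd_of_eq (by push_cast; ring))
    obtain ⟨p, hp⟩ := hline (D u₀.1) heven (hT0 u₀ hu₀)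
    have hn0 : (2 * n : ℤ) ≠ 0 := by omega
    -- This number of steps brings the second coordinate to `p + D u₀`, hence the first to `p`.
    obtain ⟨u, hu, hDu, hk⟩ := hall ((pos u₀.1.2 - p - D u₀.1) % (2 * n)).toNat
    rw [Int.toNat_of_nonneg (Int.emod_nonneg _ hn0)] at hk
    have h5 : (2 * n : ℤ) ∣ pos u.1.2 - (p + D u₀.1) := by
      have := Int.dvd_self_sub_emod (x := pos u₀.1.2 - p - D u₀.1) (m := 2 * n)
      exact (dvd_add hk this).trans (dvd_of_eq (by ring))
    have h6 : (2 * n : ℤ) ∣ pos u.1.1 - p := by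
      exact (dvd_sub h5 (hD u.1 u.2)).trans (dvd_of_eq (by rw [hDu]; ring))
    refine hp ?_
    rw [← pt_eq_pt_iff.2 h5, ← pt_eq_pt_iff.2 h6, pt_pos, pt_pos]
    exact ⟨u.2, hDu⟩
  have hhom := homotopic_of_no_translate hn hE hD₀ hT
  refine hasPathSection_of_homotopic ?_
  convert hhom using 1
  · ext u
    have := pt_eq_pt_iff.2 (hD u.1 u.2)
    rw [pt_pos] at this
    exact this.symm
  · ext u
    exact (pt_pos _).symm

end KhalimskyCircle

namespace KhalimskyCircle

variable {n : ℕ}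

/-- The specialization relation between positions on the Khalimsky circle. -/
def PosSpecializes (n : ℕ) (p p' : ℤ) : Prop :=
  p' = p ∨ p % 2 = 0 ∧ (p' = p + 1 ∨ p' = p - 1 ∨ p = 0 ∧ p' = 2 * n - 1)

/-- The subset of the torus described by a condition on positions. -/
def posSet (n : ℕ) (Q : ℤ → ℤ → Prop) : Set (KhalimskyCircle n × KhalimskyCircle n) :=
  {z | Q (pos z.1) (pos z.2)}

/-- Position of a point, as an integer in `[0, 2n)`. -/
def IsPos (n : ℕ) (p : ℤ) : Prop := 0 ≤ p ∧ p < 2 * n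

theorem posStep_cases {p p' : ℤ} (h : PosSpecializes n p p') :
    p' = p ∧ posStep p p' = 0 ∨ p % 2 = 0 ∧ (p' = p + 1 ∧ posStep p p' = 1 ∨
      p' = p - 1 ∧ posStep p p' = -1 ∨ p = 0 ∧ p' = 2 * n - 1 ∧ posStep p p' = -1) := by
  unfold PosSpecializes at h
  unfold posStep
  split_ifs <;> omega

variable [NeZero n]

theorem isPos_pos (x : KhalimskyCircle n) : IsPos n (pos x) := ⟨pos_nonneg x, pos_lt x⟩

theorem posSpecializes_of_specializes {x y : KhalimskyCircle n} (h : x ⤳ y) :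
    PosSpecializes n (pos x) (pos y) := by
  simpa only [PosSpecializes, Int.even_iff] using pos_of_specializes h

theorem isOpen_posSet {Q : ℤ → ℤ → Prop}
    (h : ∀ p q p' q', IsPos n p → IsPos n q → IsPos n p' → IsPos n q' → PosSpecializes n p p' →
      PosSpecializes n q q' → Q p' q' → Q p q) : IsOpen (posSet n Q) :=
  isOpen_iff_forall_specializes.2 fun _ _ hzw hw =>
    h _ _ _ _ (isPos_pos _) (isPos_pos _) (isPos_pos _) (isPos_pos _)
      (posSpecializes_of_specializes hzw.fst) (posSpecializes_of_specializes hzw.snd) hw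

theorem hasPathSection_posSet (hn : 2 ≤ n) {Q : ℤ → ℤ → Prop} (d : ℤ → ℤ → ℤ)
    (hd : ∀ p q, IsPos n p → IsPos n q → Q p q → ∃ c, q - d p q - p = 2 * n * c)
    (hstep : ∀ p q p' q', IsPos n p → IsPos n q → IsPos n p' → IsPos n q' →
      PosSpecializes n p p' → PosSpecializes n q q' → Q p q → Q p' q' →
      d p' q' - d p q = posStep q q' - posStep p p')
    (hline : ∀ K : ℤ, K % 2 = 0 → K ≠ 0 → ∃ p : ℤ, ¬ (Q (pos (pt n p)) (pos (pt n (p + K))) ∧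
      d (pos (pt n p)) (pos (pt n (p + K))) = K)) :
    HasPathSection (posSet n Q) :=
  hasPathSection_of_displacement hn (fun z => d (pos z.1) (pos z.2))
    (fun _ hz => hd _ _ (isPos_pos _) (isPos_pos _) hz)
    (fun _ hz _ hw hzw => hstep _ _ _ _ (isPos_pos _) (isPos_pos _) (isPos_pos _) (isPos_pos _)
      (posSpecializes_of_specializes hzw.fst) (posSpecializes_of_specializes hzw.snd) hz hw)
    hline

/-! ### Complements of crosses: planners with three or four sets. -/

section Rectangle

/-- The torus with one row and one column of closed points removed. -/
def crossCompl (r c p q : ℤ) : Prop := p ≠ 2 * r + 1 ∧ q ≠ 2 * c + 1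

theorem isOpen_crossCompl (r c : ℤ) : IsOpen (posSet n (crossCompl r c)) := by
  refine isOpen_posSet fun p q p' q' hp hq hp' hq' h1 h2 h => ?_
  unfold crossCompl PosSpecializes IsPos at *
  omega

theorem hasPathSection_crossCompl (hn : 2 ≤ n) {r c : ℤ} (hr : 0 ≤ r) (hr' : r < n)
    (hc : 0 ≤ c) (hc' : c < n) :
    HasPathSection (posSet n (crossCompl r c)) := by
  -- Cutting the circle at `2 * r + 1` leaves an arc, on which `l r` is an integer lift of the
  -- position.
  let l : ℤ → ℤ → ℤ := fun r p => if p ≤ 2 * r + 1 then p + 2 * n else p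
  have hl : ∀ r p, (p ≤ 2 * r + 1 ∧ l r p = p + 2 * n) ∨ (2 * r + 1 < p ∧ l r p = p) := by
    intro r p
    simp only [l]
    split_ifs <;> omega
  refine hasPathSection_posSet hn (fun p q => l c q - l r p) ?_ ?_ ?_
  · intro p q hp hq _
    rcases hl c q with ⟨-, h⟩ | ⟨-, h⟩ <;> rcases hl r p with ⟨-, h'⟩ | ⟨-, h'⟩ <;>
      simp only [h, h']
    exacts [⟨0, by ring⟩, ⟨-1, by ring⟩, ⟨1, by ring⟩, ⟨0, by ring⟩]
  · have key : ∀ r p p' : ℤ, 0 ≤ r → r < n → IsPos n p → IsPos n p' → PosSpecializes n p p' → p ≠ 2 * r + 1 →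
        p' ≠ 2 * r + 1 → l r p' - l r p = posStep p p' := by
      intro r p p' hr hr' hp hp' h h1 h2
      have := hl r p
      have := hl r p'
      have := posStep_cases h
      unfold IsPos at *
      omega
    intro p q p' q' hp hq hp' hq' h1 h2 hQ hQ'
    have := key r p p' hr hr' hp hp' h1 hQ.1 hQ'.1
    have := key c q q' hc hc' hq hq' h2 hQ.2 hQ'.2
    omega
  · intro K _ _
    refine ⟨2 * r + 1, fun h => h.1.1 ?_⟩
    exact pos_pt_eq (by simp) (by omega) (by omega)

/-- Each coordinate of a point lies on at most one of the three diagonal crosses, so some cross is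
avoided. -/
theorem hasMotionPlanner_two_of_three_le (hn : 3 ≤ n) : HasMotionPlanner (KhalimskyCircle n) 2 := by
  refine ⟨fun i => posSet n (crossCompl (i : ℕ) (i : ℕ)), fun i => isOpen_crossCompl _ _, ?_,
    fun i =>
      hasPathSection_crossCompl (by omega) (by omega) (by omega) (by omega) (by omega)⟩
  refine Set.eq_univ_of_forall fun z => ?_
  simp only [Set.mem_iUnion]
  by_contra hcon
  push Not at hcon
  have h0 := hcon 0
  have h1 := hcon 1
  have h2 := hcon 2
  simp only [posSet, crossCompl, Set.mem_ofPred_eq, not_and_or, not_not, Fin.val_zero, Fin.val_one,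
    Fin.val_two] at h0 h1 h2
  omega

/-- The row and the column to remove can be chosen independently, each avoiding the point. -/
theorem hasMotionPlanner_three_of_two_le (hn : 2 ≤ n) : HasMotionPlanner (KhalimskyCircle n) 3 := by
  refine ⟨fun i => posSet n (crossCompl ((i : ℕ) / 2 : ℕ) ((i : ℕ) % 2 : ℕ)),
    fun i => isOpen_crossCompl _ _, ?_,
    fun i =>
      hasPathSection_crossCompl (by omega) (by omega) (by omega) (by omega) (by omega)⟩
  refine Set.eq_univ_of_forall fun z => ?_
  simp only [Set.mem_iUnion]
  by_contra hcon
  push Not at hcon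
  have h0 := hcon 0
  have h1 := hcon 1
  have h2 := hcon 2
  have h3 := hcon 3
  simp [posSet, crossCompl] at h0 h1 h2 h3
  omega

end Rectangle

end KhalimskyCircle

/-! ### Two sets for `n ≥ 5`. -/

namespace KhalimskyCircle

variable {n : ℕ}

/-- A neighbourhood of a staircase in the torus that winds once around both factors. -/
def staircase (n : ℕ) (p q : ℤ) : Prop :=
  p ≤ 6 ∧ (q = 0 ∨ 2 * n - 2 ≤ q) ∨ 4 ≤ p ∧ p ≤ 6 ∧ (q ≤ 4 ∨ 2 * n - 2 ≤ q) ∨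
    4 ≤ p ∧ 2 ≤ q ∧ q ≤ 4 ∨ p ≤ 2 ∧ 2 ≤ q

/-- The least open set that covers the complement of the staircase. -/
def costaircase (n : ℕ) (p q : ℤ) : Prop :=
  p = 0 ∧ q ≠ 3 ∨ p = 1 ∧ q ≤ 2 ∨ 2 ≤ p ∧ p ≤ 4 ∧ q ≠ 2 * n - 1 ∨
    p = 5 ∧ 4 ≤ q ∧ q ≤ 2 * n - 2 ∨ 6 ≤ p ∧ q ≠ 3

theorem staircase_or_costaircase {p q : ℤ} (hp : IsPos n p) (hq : IsPos n q) :
    staircase n p q ∨ costaircase n p q := by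
  unfold staircase costaircase IsPos at *
  omega

variable [NeZero n]

theorem isOpen_staircase (hn : 5 ≤ n) : IsOpen (posSet n (staircase n)) := by
  refine isOpen_posSet fun p q p' q' hp hq hp' hq' h1 h2 h => ?_
  unfold staircase PosSpecializes IsPos at *
  omega

theorem isOpen_costaircase (hn : 5 ≤ n) : IsOpen (posSet n (costaircase n)) := by
  refine isOpen_posSet fun p q p' q' hp hq hp' hq' h1 h2 h => ?_
  unfold costaircase PosSpecializes IsPos at *
  omega

theorem pos_pt_spec (k : ℤ) : IsPos n (pos (pt n k)) ∧ (pos (pt n k) - k) % 2 = 0 :=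
  ⟨isPos_pos _, Int.emod_eq_zero_of_dvd ((Dvd.intro _ rfl).trans (dvd_pos_pt_sub k))⟩

theorem hasPathSection_staircase (hn : 5 ≤ n) : HasPathSection (posSet n (staircase n)) := by
  -- The difference `q - p` jumps by `2 * n` where the staircase crosses `p = 0` or `q = 0`; the
  -- correction applies between these crossings.
  let d : ℤ → ℤ → ℤ := fun p q =>
    if 2 * n - 2 ≤ q ∨ p ≤ 2 ∧ 2 ≤ q then q - p - 2 * n else q - p
  have hd : ∀ p q : ℤ, (2 * n - 2 ≤ q ∨ p ≤ 2 ∧ 2 ≤ q) ∧ d p q = q - p - 2 * n ∨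
      ¬ (2 * n - 2 ≤ q ∨ p ≤ 2 ∧ 2 ≤ q) ∧ d p q = q - p := by
    intro p q
    simp only [d]
    split_ifs <;> omega
  refine hasPathSection_posSet (by omega) d ?_ ?_ ?_
  · intro p q hp hq _
    rcases hd p q with h | h
    · exact ⟨1, by omega⟩
    · exact ⟨0, by omega⟩
  · intro p q p' q' hp hq hp' hq' h1 h2 hQ hQ'
    have c1 := posStep_cases h1
    have c2 := posStep_cases h2
    have e1 := hd p q
    have e2 := hd p' q'
    clear_value d
    clear hd h1 h2
    unfold IsPos staircase at *
    generalize posStep p p' = s at *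
    generalize posStep q q' = t at *
    generalize d p q = u at *
    generalize d p' q' = v at *
    rcases c1 with c1 | ⟨c0, c1 | c1 | c1⟩ <;> rcases c2 with c2 | ⟨c0', c2 | c2 | c2⟩ <;>
      rcases e1 with e1 | e1 <;> rcases e2 with e2 | e2 <;> omega
  · intro K hK _
    by_contra hcon
    push Not at hcon
    -- Over `p = 3` the only odd `q` is `2 * n - 1`, so `K` is `-4` modulo `2 * n` and the translate
    -- passes through `(9, 5)`, which is not in the set. Position 9 exists since `n ≥ 5`.
    have h3 := (hcon 3).1
    have h9 := (hcon 9).1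
    obtain ⟨hq, hq'⟩ := pos_pt_spec (n := n) (3 + K)
    rw [pos_pt_eq (l := 3) (by simp) (by omega) (by omega)] at h3
    rw [pos_pt_eq (l := 9) (by simp) (by omega) (by omega)] at h9
    have hK' : pos (pt n (3 + K)) = 2 * n - 1 := by
      unfold staircase IsPos at *
      omega
    have h := dvd_pos_pt_sub (n := n) (3 + K)
    rw [hK'] at h
    have h5 : (2 * n : ℤ) ∣ 9 + K - 5 :=
      (dvd_sub (dvd_refl (2 * n : ℤ)) h).trans (dvd_of_eq (by ring))
    rw [pos_pt_eq h5 (by omega) (by omega)] at h9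
    unfold staircase at h9
    omega

theorem hasPathSection_costaircase (hn : 5 ≤ n) : HasPathSection (posSet n (costaircase n)) := by
  let d : ℤ → ℤ → ℤ := fun p q =>
    if p = 0 ∧ 4 ≤ q then q - p - 2 * n else if 6 ≤ p ∧ q ≤ 2 then q - p + 2 * n else q - p
  have hd : ∀ p q : ℤ, p = 0 ∧ 4 ≤ q ∧ d p q = q - p - 2 * n ∨
      6 ≤ p ∧ q ≤ 2 ∧ d p q = q - p + 2 * n ∨
      ¬ (p = 0 ∧ 4 ≤ q) ∧ ¬ (6 ≤ p ∧ q ≤ 2) ∧ d p q = q - p := by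
    intro p q
    simp only [d]
    split_ifs <;> omega
  refine hasPathSection_posSet (by omega) d ?_ ?_ ?_
  · intro p q hp hq _
    rcases hd p q with h | h | h
    · exact ⟨1, by omega⟩
    · exact ⟨-1, by omega⟩
    · exact ⟨0, by omega⟩
  · intro p q p' q' hp hq hp' hq' h1 h2 hQ hQ'
    have c1 := posStep_cases h1
    have c2 := posStep_cases h2
    have e1 := hd p q
    have e2 := hd p' q'
    clear_value d
    clear hd h1 h2
    unfold IsPos costaircase at *
    generalize posStep p p' = s at *
    generalize posStep q q' = t at *
    generalize d p q = u at *
    generalize d p' q' = v at *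
    rcases c1 with c1 | ⟨c0, c1 | c1 | c1⟩ <;> rcases c2 with c2 | ⟨c0', c2 | c2 | c2⟩ <;>
      rcases e1 with e1 | e1 | e1 <;> rcases e2 with e2 | e2 | e2 <;> omega
  · intro K hK hK0
    -- Over `p = 1` the only odd `q` is 1, where the displacement vanishes.
    refine ⟨1, fun ⟨h1, h2⟩ => hK0 ?_⟩
    obtain ⟨hq, hq'⟩ := pos_pt_spec (n := n) (1 + K)
    rw [pos_pt_eq (l := 1) (by simp) (by omega) (by omega)] at h1 h2
    have hd' := hd 1 (pos (pt n (1 + K)))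
    rw [h2] at hd'
    unfold costaircase at h1
    unfold IsPos at hq
    omega

theorem hasMotionPlanner_one_of_five_le (hn : 5 ≤ n) : HasMotionPlanner (KhalimskyCircle n) 1 := by
  refine ⟨![posSet n (staircase n), posSet n (costaircase n)], ?_, ?_, ?_⟩
  · rw [Fin.forall_fin_two]
    exact ⟨isOpen_staircase hn, isOpen_costaircase hn⟩
  · refine Set.eq_univ_of_forall fun z => Set.mem_iUnion.2 ?_
    rcases staircase_or_costaircase (isPos_pos z.1) (isPos_pos z.2) with h | h
    exacts [⟨0, h⟩, ⟨1, h⟩]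
  · rw [Fin.forall_fin_two]
    exact ⟨hasPathSection_staircase hn, hasPathSection_costaircase hn⟩

end KhalimskyCircle

/-! ### Exhaustive search over two-colourings. -/

section Search

/-- Exhaustive search over the two-colourings of the cells in a list, where `u` and `v` are the bit
masks of the cells coloured so far: does each of them contain a monochromatic mask from `L`? -/
def monochromaticSearch (L : List ℕ) : List ℕ → ℕ → ℕ → Bool
  | [], u, v => L.any fun m => Nat.beq (m &&& u) m || Nat.beq (m &&& v) m
  | k :: o, u, v => (L.any fun m => Nat.beq (m &&& u) m || Nat.beq (m &&& v) m) ||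
      (monochromaticSearch L o (u ||| 2 ^ k) v && monochromaticSearch L o u (v ||| 2 ^ k))

theorem exists_monochromatic_of_any {L : List ℕ} {u v : ℕ} {c : ℕ → Prop}
    (hu : ∀ i, u.testBit i → c i) (hv : ∀ i, v.testBit i → ¬ c i)
    (h : (L.any fun m => Nat.beq (m &&& u) m || Nat.beq (m &&& v) m) = true) :
    ∃ m ∈ L, (∀ i, m.testBit i → c i) ∨ ∀ i, m.testBit i → ¬ c i := by
  obtain ⟨m, hm, h⟩ := List.any_eq_true.1 h
  refine ⟨m, hm, ?_⟩
  have key : ∀ {w : ℕ}, m &&& w = m → ∀ i, m.testBit i → w.testBit i := by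
    intro w hw i hi
    rw [← hw, Nat.testBit_and, Bool.and_eq_true] at hi
    exact hi.2
  rcases Bool.or_eq_true_iff.1 h with h | h
  · exact .inl fun i hi => hu i (key (Nat.eq_of_beq_eq_true h) i hi)
  · exact .inr fun i hi => hv i (key (Nat.eq_of_beq_eq_true h) i hi)

theorem exists_monochromatic_of_search {L : List ℕ} {c : ℕ → Prop} (o : List ℕ) {u v : ℕ}
    (hu : ∀ i, u.testBit i → c i) (hv : ∀ i, v.testBit i → ¬ c i)
    (h : monochromaticSearch L o u v = true) :
    ∃ m ∈ L, (∀ i, m.testBit i → c i) ∨ ∀ i, m.testBit i → ¬ c i := by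
  induction o generalizing u v with
  | nil => exact exists_monochromatic_of_any hu hv h
  | cons k o ih =>
    rw [monochromaticSearch, Bool.or_eq_true, Bool.and_eq_true] at h
    rcases h with h | ⟨h1, h2⟩
    · exact exists_monochromatic_of_any hu hv h
    have key : ∀ {w i : ℕ}, (w ||| 2 ^ k).testBit i → w.testBit i ∨ i = k := by
      intro w i hi
      rw [Nat.testBit_or, Bool.or_eq_true, Nat.testBit_two_pow, decide_eq_true_iff] at hi
      exact hi.imp_right Eq.symm
    by_cases hk : c k
    · exact ih (fun i hi => (key hi).elim (hu i) fun h => h ▸ hk) hv h1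
    · exact ih hu (fun i hi => (key hi).elim (hv i) fun h => h ▸ hk) h2

end Search

/-! ### Monochromatic king paths in the grid of closed points. -/

namespace KhalimskyCircle

variable {n : ℕ}

/-- Successive values of a function on `ℤ/n` differ by at most one. -/
def IsKingPath (j : ZMod n → ZMod n) : Prop :=
  ∀ i, j (i + 1) = j i ∨ j (i + 1) = j i + 1 ∨ j (i + 1) + 1 = j i

instance [NeZero n] (j : ZMod n → ZMod n) : Decidable (IsKingPath j) := by
  unfold IsKingPath
  have := ZMod.fintype n
  infer_instance

/-- The function on `ℤ/n` with the given list of values. -/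
def pathOfList (n : ℕ) (l : List ℕ) (i : ZMod n) : ZMod n :=
  (l.getD i.val 0 : ℕ)

/-- The index of the cell at `i` of a graph in the torus grid: the graph of the function given by
the list, or the transpose of the graph if the flag is not set. -/
def graphCell (n : ℕ) (e : Bool × List ℕ) (i : ZMod n) : ℕ :=
  if e.1 then n * i.val + (pathOfList n e.2 i).val else n * (pathOfList n e.2 i).val + i.val

/-- The bit mask of a graph in the torus grid. -/
def graphMask (n : ℕ) (e : Bool × List ℕ) : ℕ :=
  (List.range n).foldl (fun m i => m ||| 2 ^ graphCell n e (i : ZMod n)) 0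

/-- `data` is a certificate listing enough paths and `L` holds their masks as literals for the
search. The order `o` of the cells does not matter for soundness. -/
theorem exists_monochromatic_graph [NeZero n] {data : List (Bool × List ℕ)} {L o : List ℕ}
    (hdata : ∀ e ∈ data, IsKingPath (pathOfList n e.2) ∧ (∃ i, pathOfList n e.2 i ≠ i) ∧
      ∀ i, (graphMask n e).testBit (graphCell n e i) = true)
    (hL : data.map (graphMask n) = L) (ho : monochromaticSearch L o 0 0 = true)
    (Q : ZMod n → ZMod n → Prop) :
    ∃ j : ZMod n → ZMod n, IsKingPath j ∧ (∃ i, j i ≠ i) ∧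
      ((∀ i, Q i (j i)) ∨ (∀ i, ¬ Q i (j i)) ∨ (∀ i, Q (j i) i) ∨ ∀ i, ¬ Q (j i) i) := by
  let c : ℕ → Prop := fun k => Q ((k / n : ℕ) : ZMod n) ((k % n : ℕ) : ZMod n)
  have hc : ∀ x y : ZMod n, c (n * x.val + y.val) ↔ Q x y := by
    intro x y
    have hn : 0 < n := NeZero.pos n
    have h1 : (n * x.val + y.val) / n = x.val := by
      rw [Nat.mul_add_div hn, Nat.div_eq_of_lt y.val_lt, add_zero]
    have h2 : (n * x.val + y.val) % n = y.val := by
      rw [Nat.mul_add_mod, Nat.mod_eq_of_lt y.val_lt]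
    simp only [c, h1, h2, ZMod.natCast_zmod_val]
  obtain ⟨m, hm, h⟩ := exists_monochromatic_of_search (c := c) o (by simp) (by simp) ho
  rw [← hL, List.mem_map] at hm
  obtain ⟨⟨r, l⟩, he, rfl⟩ := hm
  obtain ⟨h1, h2, h3⟩ := hdata _ he
  refine ⟨pathOfList n l, h1, h2, ?_⟩
  cases r
  · right; right
    refine h.imp (fun h i => ?_) fun h i => ?_
    · simpa [graphCell, hc] using h _ (h3 i)
    · simpa [graphCell, hc] using h _ (h3 i)
  · rw [← or_assoc]
    left
    refine h.imp (fun h i => ?_) fun h i => ?_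
    · simpa [graphCell, hc] using h _ (h3 i)
    · simpa [graphCell, hc] using h _ (h3 i)

theorem exists_monochromatic_graph_three (Q : ZMod 3 → ZMod 3 → Prop) :
    ∃ j : ZMod 3 → ZMod 3, IsKingPath j ∧ (∃ i, j i ≠ i) ∧
      ((∀ i, Q i (j i)) ∨ (∀ i, ¬ Q i (j i)) ∨ (∀ i, Q (j i) i) ∨ ∀ i, ¬ Q (j i) i) :=
  exists_monochromatic_graph (data := [
      (true, [0, 1, 1]), (true, [1, 2, 1]), (true, [0, 0, 1]), (true, [0, 2, 2]),
      (true, [0, 2, 0]), (true, [2, 2, 2]), (false, [1, 2, 2]), (false, [2, 1, 2]),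
      (false, [1, 0, 0]), (false, [1, 1, 1]), (false, [0, 0, 2])])
    (L := [
      145, 162, 137, 289, 97, 292, 392, 336, 14, 56, 259])
    (o := [0, 1, 2, 3, 4, 5, 6, 7, 8])
    (by decide +kernel) (by decide +kernel) (by decide +kernel) Q

theorem exists_monochromatic_graph_four (Q : ZMod 4 → ZMod 4 → Prop) :
    ∃ j : ZMod 4 → ZMod 4, IsKingPath j ∧ (∃ i, j i ≠ i) ∧
      ((∀ i, Q i (j i)) ∨ (∀ i, ¬ Q i (j i)) ∨ (∀ i, Q (j i) i) ∨ ∀ i, ¬ Q (j i) i) :=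
  exists_monochromatic_graph (data := [
      (true, [1, 1, 1, 2]), (true, [1, 0, 0, 0]), (true, [3, 0, 0, 0]),
      (true, [3, 3, 3, 0]), (true, [0, 0, 0, 0]), (true, [0, 0, 1, 0]),
      (true, [0, 0, 3, 0]), (true, [1, 2, 2, 2]), (true, [2, 2, 2, 2]),
      (true, [1, 2, 1, 2]), (true, [2, 2, 1, 2]), (true, [2, 3, 2, 2]),
      (true, [3, 2, 3, 2]), (true, [2, 2, 3, 2]), (true, [1, 0, 1, 0]),
      (true, [3, 2, 2, 2]), (true, [1, 0, 3, 0]), (true, [0, 1, 2, 1]),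
      (true, [2, 1, 0, 1]), (true, [0, 3, 0, 0]), (true, [0, 3, 2, 1]),
      (true, [2, 3, 0, 1]), (true, [3, 0, 3, 2]), (true, [1, 2, 3, 0]),
      (true, [3, 2, 1, 2]), (true, [3, 2, 3, 0]), (true, [3, 0, 3, 0]),
      (true, [1, 0, 3, 2]), (true, [1, 2, 3, 2]), (false, [2, 2, 2, 2]),
      (false, [1, 1, 1, 0]), (false, [0, 0, 0, 0]), (false, [1, 0, 1, 1]),
      (false, [2, 2, 3, 2]), (false, [2, 2, 1, 2]), (false, [0, 1, 2, 1]),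
      (false, [1, 2, 2, 2]), (false, [0, 0, 0, 1]), (false, [0, 0, 1, 0]),
      (false, [3, 2, 2, 2]), (false, [0, 0, 3, 0]), (false, [1, 0, 0, 0]),
      (false, [1, 2, 3, 0]), (false, [1, 2, 3, 2]), (false, [3, 2, 1, 2]),
      (false, [2, 1, 0, 1]), (false, [3, 0, 0, 0]), (false, [1, 2, 1, 0]),
      (false, [3, 0, 3, 2]), (false, [3, 2, 3, 2]), (false, [1, 0, 1, 2]),
      (false, [3, 0, 3, 0]), (false, [3, 0, 1, 0]), (false, [2, 2, 2, 1])])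
    (L := [
      16930, 4370, 4376, 6280, 4369, 4625, 6161, 17474, 17476, 16962, 16964, 17540, 18504,
      18500, 4626, 17480, 6162, 9249, 8484, 4481, 9345, 8580, 18456, 6210, 16968, 6216,
      6168, 18450, 18498, 3840, 120, 15, 210, 19200, 2880, 1185, 3600, 135, 75, 7680,
      16395, 30, 16920, 18960, 6720, 420, 4110, 600, 22530, 23040, 2130, 20490, 4170, 1920])
    (o := [11, 3, 6, 12, 1, 4, 14, 9, 2, 10, 0, 8, 7, 5, 13, 15])
    (by decide +kernel) (by decide +kernel) (by decide +kernel) Q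

end KhalimskyCircle

/-! ### Rigidity, lower bounds and the final values. -/

namespace KhalimskyCircle

variable {n : ℕ}

theorem a_specializes_b (i : ZMod n) : (a i : KhalimskyCircle n) ⤳ b i :=
  specializes_b_iff.2 (.inl rfl)

theorem a_add_one_specializes_b (i : ZMod n) : (a (i + 1) : KhalimskyCircle n) ⤳ b i :=
  specializes_b_iff.2 (.inr (.inr rfl))

/-- The self-map of the Khalimsky circle that is given by a path on the closed points. -/
def kingMap (j : ZMod n → ZMod n) : KhalimskyCircle n → KhalimskyCircle n
  -- The image of `a i` must specialize to both `b (j (i - 1))` and `b (j i)`; after a backward step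
  -- of `j` only `a (j i + 1)` is sure to do so.
  | a i => if j i + 1 = j (i - 1) then a (j i + 1) else a (j i)
  | b i => b (j i)

/-- Comparability fixes all points of one kind, open or closed; each remaining point is determined
by its two distinct neighbours. -/
theorem eq_id_of_comparable (hn : 2 ≤ n) (f : C(KhalimskyCircle n, KhalimskyCircle n))
    (hf : (∀ x, f x ⤳ x) ∨ ∀ x, x ⤳ f x) : f = ContinuousMap.id _ := by
  have : Fact (1 < n) := ⟨hn⟩
  have ha : ∀ i, f (a i) ⤳ f (b i) := fun i => (a_specializes_b i).map f.continuous
  have ha' : ∀ i, f (a (i + 1)) ⤳ f (b i) := fun i => (a_add_one_specializes_b i).map f.continuous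
  rcases hf with hf | hf
  · have hfa : ∀ i, f (a i) = a i := fun i => specializes_a_iff.1 (hf (a i))
    ext x
    cases x with
    | a i => exact hfa i
    | b i =>
      have h1 := ha i
      have h2 := ha' i
      rw [hfa] at h1 h2
      rcases specializes_b_iff.1 (hf (b i)) with h | h | h
      · rw [h, specializes_a_iff] at h2
        simp at h2
      · exact h
      · rw [h, specializes_a_iff] at h1
        simp at h1
  · have hfb : ∀ i, f (b i) = b i := by
      intro i
      have h := hf (b i)
      cases hx : f (b i) with
      | a k => rw [hx, specializes_a_iff] at h; simp at h
      | b k =>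
        rw [hx, specializes_b_iff] at h
        simpa [eq_comm] using h
    ext x
    cases x with
    | b i => exact hfb i
    | a i =>
      have h1 := ha i
      have h2 := ha' (i - 1)
      rw [sub_add_cancel] at h2
      rw [hfb, specializes_b_iff] at h1 h2
      have h3 := hf (a i)
      cases hx : f (a i) with
      | a k => rw [hx, specializes_a_iff] at h3; simpa using h3.symm
      | b k =>
        rw [hx] at h1 h2
        simp only [reduceCtorEq, b.injEq, or_false, false_or] at h1 h2
        rw [h1] at h2
        have : (1 : ZMod n) = 0 := by
          have := sub_eq_self.1 h2.symm
          exact this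
        simp at this

section NeZero

variable [NeZero n]

theorem continuous_kingMap {j : ZMod n → ZMod n} (hj : IsKingPath j) :
    Continuous (kingMap j) := by
  refine continuous_of_forall_specializes fun x y hxy => ?_
  cases y with
  | a i =>
    rw [specializes_a_iff] at hxy
    rw [hxy]
  | b i =>
    rcases specializes_b_iff.1 hxy with rfl | rfl | rfl
    · simp only [kingMap]
      split_ifs
      exacts [a_add_one_specializes_b _, a_specializes_b _]
    · rfl
    · simp only [kingMap, add_sub_cancel_right]
      split_ifs with h
      · rw [h]
        exact a_specializes_b _
      · rcases hj i with h' | h' | h'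
        · rw [h']
          exact a_specializes_b _
        · rw [h']
          exact a_add_one_specializes_b _
        · exact absurd h' h

/-- An open set with a path section contains no graph of a self-map over the closed points,
except for the identity. -/
theorem eq_id_of_graph_subset (hn : 2 ≤ n) {U : Set (KhalimskyCircle n × KhalimskyCircle n)}
    (hU : IsOpen U) (hs : HasPathSection U) {h : KhalimskyCircle n → KhalimskyCircle n}
    (hc : Continuous h) (hg : (∀ i, (b i, h (b i)) ∈ U) ∨ ∀ i, (h (b i), b i) ∈ U) : h = id := by
  have key : (ContinuousMap.id _).Homotopic ⟨h, hc⟩ := by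
    rcases hg with hg | hg
    · refine hs.homotopic fun x => ?_
      cases x with
      | a i =>
        exact (specializes_prod.2 ⟨a_specializes_b i, (a_specializes_b i).map hc⟩).mem_open hU (hg i)
      | b i => exact hg i
    · refine (hs.homotopic fun x => ?_).symm
      cases x with
      | a i =>
        exact (specializes_prod.2 ⟨(a_specializes_b i).map hc, a_specializes_b i⟩).mem_open hU (hg i)
      | b i => exact hg i
  have := eq_id_of_homotopic (eq_id_of_comparable hn) key
  exact congrArg DFunLike.coe this

theorem eq_self_of_kingPath_subset (hn : 2 ≤ n)
    {U : Set (KhalimskyCircle n × KhalimskyCircle n)} (hU : IsOpen U) (hs : HasPathSection U)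
    {j : ZMod n → ZMod n} (hj : IsKingPath j)
    (hg : (∀ i, (b i, b (j i)) ∈ U) ∨ ∀ i, (b (j i), b i) ∈ U) (i : ZMod n) : j i = i := by
  have h := congrFun (eq_id_of_graph_subset hn hU hs (continuous_kingMap hj) hg) (b i)
  simpa [kingMap] using h

theorem not_hasMotionPlanner_zero (hn : 2 ≤ n) : ¬ HasMotionPlanner (KhalimskyCircle n) 0 := by
  rintro ⟨U, hU, hcov, hs⟩
  have : Fact (1 < n) := ⟨hn⟩
  have hcov' : ∀ z, z ∈ U 0 := by
    intro z
    obtain ⟨i, hi⟩ := Set.mem_iUnion.1 (Set.eq_univ_iff_forall.1 hcov z)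
    fin_cases i
    exact hi
  have := eq_self_of_kingPath_subset hn (hU 0) (hs 0) (j := fun _ => 0) (fun i => .inl rfl)
    (.inl fun i => hcov' _) 1
  simp at this

theorem not_hasMotionPlanner_one (hn : 2 ≤ n)
    (hg : ∀ Q : ZMod n → ZMod n → Prop, ∃ j : ZMod n → ZMod n, IsKingPath j ∧ (∃ i, j i ≠ i) ∧
      ((∀ i, Q i (j i)) ∨ (∀ i, ¬ Q i (j i)) ∨ (∀ i, Q (j i) i) ∨ ∀ i, ¬ Q (j i) i)) :
    ¬ HasMotionPlanner (KhalimskyCircle n) 1 := by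
  rintro ⟨U, hU, hcov, hs⟩
  have hcov' : ∀ z, z ∉ U 0 → z ∈ U 1 := by
    intro z hz
    obtain ⟨i, hi⟩ := Set.mem_iUnion.1 (Set.eq_univ_iff_forall.1 hcov z)
    fin_cases i
    exacts [absurd hi hz, hi]
  obtain ⟨j, hj, ⟨i, hi⟩, h⟩ := hg fun x y => (b x, b y) ∈ U 0
  refine hi ?_
  rcases h with h | h | h | h
  · exact eq_self_of_kingPath_subset hn (hU 0) (hs 0) hj (.inl h) i
  · exact eq_self_of_kingPath_subset hn (hU 1) (hs 1) hj (.inl fun i => hcov' _ (h i)) i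
  · exact eq_self_of_kingPath_subset hn (hU 0) (hs 0) hj (.inr h) i
  · exact eq_self_of_kingPath_subset hn (hU 1) (hs 1) hj (.inr fun i => hcov' _ (h i)) i

end NeZero

/-- In `ℤ/2` forward and backward steps coincide, so every `j` is a king path, and even for `j = id`
the induced map swaps the two open points. -/
theorem not_graph_subset_two {U : Set (KhalimskyCircle 2 × KhalimskyCircle 2)} (hU : IsOpen U)
    (hs : HasPathSection U) (j : ZMod 2 → ZMod 2) :
    ¬ ((∀ i, (b i, b (j i)) ∈ U) ∨ ∀ i, (b (j i), b i) ∈ U) := by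
  intro hg
  have hj : IsKingPath j := by
    clear hg
    revert j
    decide
  have hid := eq_id_of_graph_subset le_rfl hU hs (continuous_kingMap hj) hg
  have h0 := congrFun hid (a 0)
  have hb : ∀ i, j i = i := eq_self_of_kingPath_subset le_rfl hU hs hj hg
  simp only [kingMap, hb] at h0
  rw [if_pos (by decide)] at h0
  simp at h0

theorem not_hasMotionPlanner_two : ¬ HasMotionPlanner (KhalimskyCircle 2) 2 := by
  rintro ⟨U, hU, hcov, hs⟩
  have hc : ∀ i j : ZMod 2, ∃ k, (b i, b j) ∈ U k := fun i j =>
    Set.mem_iUnion.1 (Set.eq_univ_iff_forall.1 hcov _)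
  choose c hc using hc
  have hcol : ∀ j j', c 0 j ≠ c 1 j' := by
    intro j j' h
    refine not_graph_subset_two (hU (c 0 j)) (hs (c 0 j)) ![j, j'] (.inl fun i => ?_)
    fin_cases i
    exacts [hc 0 j, h ▸ hc 1 j']
  have hrow : ∀ i i', c i 0 ≠ c i' 1 := by
    intro i i' h
    refine not_graph_subset_two (hU (c i 0)) (hs (c i 0)) ![i, i'] (.inr fun k => ?_)
    fin_cases k
    exacts [hc i 0, h ▸ hc i' 1]
  have h1 := hcol 0 0
  have h2 := hcol 0 1
  have h3 := hcol 1 0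
  have h4 := hcol 1 1
  have h5 := hrow 0 0
  have h6 := hrow 1 1
  -- The four closed points of the torus would need distinct colours out of three.
  omega

theorem topologicalComplexity_eq (n : ℕ) (hn : 2 ≤ n) :
    topologicalComplexity (KhalimskyCircle n) =
      if n = 2 then 3 else if n = 3 ∨ n = 4 then 2 else 1 := by
  have : NeZero n := ⟨by omega⟩
  by_cases h2 : n = 2
  · subst h2
    exact topologicalComplexity_eq_succ (hasMotionPlanner_three_of_two_le le_rfl)
      not_hasMotionPlanner_two
  by_cases h34 : n = 3 ∨ n = 4
  · rw [if_neg h2, if_pos h34]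
    refine topologicalComplexity_eq_succ (hasMotionPlanner_two_of_three_le (by omega)) ?_
    rcases h34 with rfl | rfl
    exacts [not_hasMotionPlanner_one (by omega) exists_monochromatic_graph_three,
      not_hasMotionPlanner_one (by omega) exists_monochromatic_graph_four]
  · rw [if_neg h2, if_neg h34]
    exact topologicalComplexity_eq_succ (hasMotionPlanner_one_of_five_le (by omega))
      (not_hasMotionPlanner_zero hn)

end KhalimskyCircle

theorem mainTheorem1 :
    (∀ n : ℕ, 2 ≤ n →
      topologicalComplexity (KhalimskyCircle n) =
        if n = 2 then 3 else if n = 3 ∨ n = 4 then 2 else 1) ∧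
    (∀ k : ℕ, 3 ≤ k → topologicalComplexity (KhalimskyCircle (2 ^ k)) ≠ 2) ∧
    ¬ (∀ k : ℕ, 1 ≤ k → topologicalComplexity (KhalimskyCircle (2 ^ k)) = 2) := by
  have hne : ∀ k : ℕ, 3 ≤ k → topologicalComplexity (KhalimskyCircle (2 ^ k)) ≠ 2 := by
    intro k hk
    have h8 : 2 ^ 3 ≤ 2 ^ k := Nat.pow_le_pow_right two_pos hk
    rw [KhalimskyCircle.topologicalComplexity_eq _ (by omega), if_neg (by omega),
      if_neg (by omega)]
    norm_num
  exact ⟨KhalimskyCircle.topologicalComplexity_eq, hne, fun h => hne 3 le_rfl (h 3 (by norm_num))⟩
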